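/- Let $\Omega=[0,1]^d$, $\mathbb{T}^d=\mathbb{R}^d/\mathbb{Z}^d$ (with its measure $d\lambda$ of total mass one), and let $A=A(x,\lambda)\in C^1(\Omega\times\mathbb{T}^d)^{d\times d}$ be a uniformly elliptic matrix-valued function, i.e. for some $r>0$, $\langle A(x,\lambda)\xi,\xi\rangle\ge r|\xi|^2$ for all $x\in\Omega$, $\lambda\in\mathbb{T}^d$, $\xi\in\mathbb{R}^d$. Let $\epsilon>0$, $L>0$, $m>1$, $\nu\in[0,1]$. *Notation.* For a two-scale coefficient $B(x,\lambda)$, 1-periodic in $\lambda$, put $(\iota^{\epsilon}B)(x):=B(x,x/\epsilon)$, and $A^\epsilon:=\iota^\epsilon A$. For $y\in\mathbb{R}$ let $\Phi(y):=(\lfloor y/L\rfloor+\nu)L$ and $\phi(y):=\frac1m(y-\Phi(y))+\Phi(y)$; both act componentwise on vectors. The local dilation operator is $(\mathcal{D}B)(x):=B(\phi(x))$; on functions on $\Omega$ it is defined at the points of $\Omega_{\mathcal D}:=\{x\in\Omega:\phi(x)\in\Omega\}$. The representative of $\mathcal{D}A^\epsilon$ at scale $m\epsilon$ is $$\widetilde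 A(x,\lambda):=A\bigl(\phi(x),\lambda+\varphi(x)\bigr),\qquad \varphi(x):=\tfrac1\epsilon\bigl(1-\tfrac1m\bigr)\Phi(x)$$ ($\varphi$ is constant on each cube $T_k:=\prod_{i}[(k_i-1)L,k_iL)$). The homogenization operator is $$(\mathcal{H}B)(x):=\int_{\mathbb{T}^d}\bigl(B(x,\lambda)+B(x,\lambda)\,\nabla_\lambda\chi(\lambda;x)^T\bigr)\,d\lambda,$$ where $(\nabla_\lambda\chi)_{jk}=\partial_{\lambda_k}\chi_j$ and the corrector $\chi(\cdot;x)\in H^1(\mathbb{T}^d)^d$ is a weak solution of the cell problem $-\nabla_\lambda\cdot(\nabla_\lambda\chi\,B^T)=\nabla_\lambda\cdot B^T$. *Claim.* 1. $\Omega_{\mathcal D}$ contains every cube $T_k$ with $1\le k_i\le 1/L$ for all $i$, and almost every point of $\Omega$ if $1/L$ is an integer. 2. $\widetilde A\in L^\infty(\Omega_{\mathcal D}\times\mathbb{T}^d)^{d\times d}$, and $\iota^{m\epsilon}\widetilde A=\mathcal{D}A^\epsilon$ on $\Omega_{\mathcal D}$. 3. $\mathcal{H}A$ on $\Omega$ and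 $\mathcal{H}\widetilde A$ on $\Omega_{\mathcal D}$ are well defined: at each point a corrector exists, and all correctors give the same value. 4. For $x\in\Omega_{\mathcal D}$, $\chi$ is a corrector of $A(\phi(x),\cdot)$ if and only if $\lambda\mapsto\chi(\lambda+\varphi(x))$ is a corrector of $\widetilde A(x,\cdot)$. 5. Homogenization commutes with local dilation: with $\overline A:=\mathcal{H}A$, $$\mathcal{H}\widetilde A(x)=\mathcal{D}\overline A(x)\qquad\text{for every }x\in\Omega_{\mathcal D},$$ i.e. $\mathcal{H}(\iota^{m\epsilon})^{-1}\mathcal{D}A^\epsilon=\mathcal{D}\mathcal{H}(\iota^\epsilon)^{-1}A^\epsilon$, where $(\iota^{\epsilon})^{-1}$ and $(\iota^{m\epsilon})^{-1}$ mean passing from $A^\epsilon$ to its representative $A$ and from $\mathcal{D}A^\epsilon$ to its representative $\widetilde A$. In particular, if $1/L$ is an integer, $\mathcal{H}\widetilde A=\mathcal{D}\overline A$ almost everywhere in $\Omega$. -/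

import Mathlib

open MeasureTheory
open scoped ContDiff

noncomputable section

namespace LocalDilation

/-- The flat torus `ℝ^d / ℤ^d`. -/
abbrev Torus (d : ℕ) : Type := UnitAddTorus (Fin d)

/-- The measure `dλ` of total mass one on the torus: the product of the Haar probability
measures of the circles. -/
def haar (d : ℕ) : Measure (Torus d) := Measure.pi fun _ => AddCircle.haarAddCircle

/-- The quotient map `ℝ^d → ℝ^d / ℤ^d`. -/
def proj {d : ℕ} (y : Fin d → ℝ) : Torus d := fun i => (y i : UnitAddCircle)

/-- Two-scale coefficients `A(x, λ)`, 1-periodic in `λ`, i.e. with `λ` in the torus. -/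
abbrev TwoScale (d : ℕ) : Type := (Fin d → ℝ) → Torus d → Matrix (Fin d) (Fin d) ℝ

/-- The macroscopic domain `Ω = [0,1]^d`. -/
def Omega (d : ℕ) : Set (Fin d → ℝ) := Set.Icc 0 1

/-- `A ∈ C¹(Ω × 𝕋^d)^{d×d}`: each entry, lifted to `ℝ^d` in the second variable, is `C¹`
up to the boundary of `Ω`. -/
def IsC1 {d : ℕ} (A : TwoScale d) : Prop :=
  ∀ i j, ContDiffOn ℝ 1 (fun p : (Fin d → ℝ) × (Fin d → ℝ) => A p.1 (proj p.2) i j)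
    (Omega d ×ˢ Set.univ)

/-- `⟨A(x, λ) ξ, ξ⟩ ≥ r |ξ|²` for all `x ∈ Ω`, `λ ∈ 𝕋^d`, `ξ ∈ ℝ^d`. -/
def IsElliptic {d : ℕ} (r : ℝ) (A : TwoScale d) : Prop :=
  ∀ x ∈ Omega d, ∀ t : Torus d, ∀ ξ : Fin d → ℝ,
    r * dotProduct ξ ξ ≤ dotProduct ((A x t).mulVec ξ) ξ

/-- `A ∈ L^∞(U × 𝕋^d; M^{d×d})`. -/
def MemLinfty {d : ℕ} (U : Set (Fin d → ℝ)) (A : TwoScale d) : Prop :=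
  ∀ i j, MemLp (fun p : (Fin d → ℝ) × Torus d => A p.1 p.2 i j) ⊤
    ((volume.restrict U).prod (haar d))

/-- The wrapping operation `(ι^ε A)(x) = A(x, x/ε)`. -/
def wrap {d : ℕ} (ε : ℝ) (A : TwoScale d) (x : Fin d → ℝ) : Matrix (Fin d) (Fin d) ℝ :=
  A x (proj fun i => x i / ε)

/-! ### Shrinkage and dilation -/

/-- The anchor function `Φ(y) = (⌊y/L⌋ + ν) L`. -/
def anchor (L ν y : ℝ) : ℝ := ((⌊y / L⌋ : ℝ) + ν) * L

/-- The shrinkage mapping `φ(y) = (y - Φ(y))/m + Φ(y)`. -/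
def shrink (L m ν y : ℝ) : ℝ := 1 / m * (y - anchor L ν y) + anchor L ν y

/-- The shrinkage mapping applied componentwise. -/
def shrinkVec {d : ℕ} (L m ν : ℝ) (x : Fin d → ℝ) : Fin d → ℝ := fun i => shrink L m ν (x i)

/-- The dilation operator `(𝒟 B)(x) = B(φ(x))`. -/
def dilate {d : ℕ} {α : Type*} (L m ν : ℝ) (B : (Fin d → ℝ) → α) : (Fin d → ℝ) → α :=
  fun x => B (shrinkVec L m ν x)

/-- The points `x` of `Ω` at which `(𝒟 B)(x)` makes sense for a function `B` on `Ω`. -/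
def dilationDomain (d : ℕ) (L m ν : ℝ) : Set (Fin d → ℝ) :=
  {x | x ∈ Omega d ∧ shrinkVec L m ν x ∈ Omega d}

/-- The cube `T_k = ∏ᵢ [(kᵢ - 1) L, kᵢ L)`. -/
def cell {d : ℕ} (L : ℝ) (k : Fin d → ℕ) : Set (Fin d → ℝ) :=
  {x | ∀ i, ((k i : ℝ) - 1) * L ≤ x i ∧ x i < (k i : ℝ) * L}

/-- The phase shift `ε⁻¹ (1 - 1/m) Φ(x)`, as a point of the torus; it is constant on each cube. -/
def phase {d : ℕ} (ε L m ν : ℝ) (x : Fin d → ℝ) : Torus d :=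
  proj fun i => 1 / ε * (1 - 1 / m) * anchor L ν (x i)

/-- The two-scale representative `Ã(x, λ) = A(φ(x), λ + ε⁻¹ (1 - 1/m) Φ(x))` of `𝒟 A^ε`. -/
def tildeCoeff {d : ℕ} (ε L m ν : ℝ) (A : TwoScale d) : TwoScale d :=
  fun x t => A (shrinkVec L m ν x) (t + phase ε L m ν x)

/-! ### The cell problem and homogenization -/

/-- Smooth functions on the torus: those with a smooth lift to `ℝ^d`. -/
def IsSmooth {d : ℕ} (ψ : Torus d → ℝ) : Prop := ContDiff ℝ ∞ fun y : Fin d → ℝ => ψ (proj y)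

/-- The partial derivative `∂_i ψ` of a function on the torus. -/
def partialDeriv {d : ℕ} (i : Fin d) (ψ : Torus d → ℝ) (t : Torus d) : ℝ :=
  deriv (fun s : ℝ => ψ (t + proj (Pi.single i s))) 0

/-- `w ∈ H¹(𝕋^d)` with weak gradient `g`. -/
structure HasWeakGradient {d : ℕ} (w : Torus d → ℝ) (g : Fin d → Torus d → ℝ) : Prop where
  memLp : MemLp w 2 (haar d)
  memLp_grad : ∀ i, MemLp (g i) 2 (haar d)
  integral_eq : ∀ ψ : Torus d → ℝ, IsSmooth ψ → ∀ i,
    ∫ t, w t * partialDeriv i ψ t ∂(haar d) = -∫ t, g i t * ψ t ∂(haar d)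

/-- `χ` is a vector of weak solutions in `H¹(𝕋^d)` of the cell problem
`-∇·(∇χ aᵀ) = ∇·aᵀ`, and `G = ∇χ`, i.e. `G_{jk} = ∂_k χ_j`. By rows, this reads
`-∑_k ∂_k (∑_l a_{kl} ∂_l χ_j) = ∑_k ∂_k a_{kj}` for all `j`. -/
structure IsCorrector {d : ℕ} (a : Torus d → Matrix (Fin d) (Fin d) ℝ)
    (χ : Torus d → Fin d → ℝ) (G : Torus d → Matrix (Fin d) (Fin d) ℝ) : Prop where
  grad : ∀ j, HasWeakGradient (fun t => χ t j) (fun k t => G t j k)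
  weak : ∀ j, ∀ (v : Torus d → ℝ) (h : Fin d → Torus d → ℝ), HasWeakGradient v h →
    ∫ t, ∑ k, (G t * (a t).transpose) j k * h k t ∂(haar d) =
      -∫ t, ∑ k, (a t).transpose j k * h k t ∂(haar d)

/-- `∫_{𝕋^d} (a + a (∇χ)ᵀ) dλ`, with `G = ∇χ`. -/
def cellAverage {d : ℕ} (a G : Torus d → Matrix (Fin d) (Fin d) ℝ) :
    Matrix (Fin d) (Fin d) ℝ :=
  Matrix.of fun i j => ∫ t, (a t + a t * (G t).transpose) i j ∂(haar d)

open Classical in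
/-- The homogenization operator `ℋ`: the cell average with a corrector `χ(·; x)` (the value `0`
is assigned where there is no corrector). -/
def homogenize {d : ℕ} (A : TwoScale d) (x : Fin d → ℝ) : Matrix (Fin d) (Fin d) ℝ :=
  if h : ∃ G, ∃ χ, IsCorrector (A x) χ G then cellAverage (A x) h.choose else 0

end LocalDilation

end

open LocalDilation

namespace LocalDilation

/-! At a fixed `x`, the coefficient `Ã(x, ·)` is `A(φ(x), ·)` translated by one torus element, the
phase. The cell problem and the measure on the torus are translation invariant, so correctors are
translated along with the coefficient (`isCorrector_comp_add_right_iff`) and the cell average does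
not change (`cellAverage_comp_add_right`).

Most of the work is to show that `homogenize` does not depend on the chosen corrector. Existence is
Lax–Milgram on the mean zero part of `H¹` (`exists_isCorrector`), with coercivity from ellipticity
and a Poincaré inequality read off Fourier coefficients. No symmetry of the matrix is needed.
Ellipticity also makes the gradient unique almost everywhere (`IsCorrector.grad_ae_eq`), and the
average sees only the gradient. On each cube the shrinkage is a convex combination with the anchor,
so it stays in the closed cube. -/

/-! ### Calculus and Haar measure on the torus. -/

lemma isOpenQuotientMap_proj {d : ℕ} : IsOpenQuotientMap (proj : (Fin d → ℝ) → Torus d) :=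
  IsOpenQuotientMap.piMap fun _ => QuotientAddGroup.isOpenQuotientMap_mk

lemma continuous_proj {d : ℕ} : Continuous (proj : (Fin d → ℝ) → Torus d) :=
  isOpenQuotientMap_proj.continuous

lemma proj_add {d : ℕ} (y z : Fin d → ℝ) : proj (y + z) = proj y + proj z := by
  ext i; simp [proj]

instance haar.isProbabilityMeasure (d : ℕ) : IsProbabilityMeasure (haar d) := by
  unfold haar; infer_instance

instance haar.isAddHaarMeasure (d : ℕ) : (haar d).IsAddHaarMeasure := by
  unfold haar; infer_instance

/-- A lift of a smooth function on the torus has the expected directional derivatives. -/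
lemma IsSmooth.hasDerivAt {d : ℕ} {ψ : Torus d → ℝ} (hψ : IsSmooth ψ) (i : Fin d)
    (y : Fin d → ℝ) (s : ℝ) :
    HasDerivAt (fun s : ℝ => ψ (proj y + proj (Pi.single i s)))
      (fderiv ℝ (fun y => ψ (proj y)) (y + Pi.single i s) (Pi.single i 1)) s := by
  have h1 : HasDerivAt (fun s : ℝ => y + Pi.single i s) (Pi.single i 1 : Fin d → ℝ) s := by
    refine HasDerivAt.const_add y ?_
    rw [hasDerivAt_pi]
    intro j
    by_cases hj : j = i
    · subst hj; simpa using hasDerivAt_id' s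
    · simpa [hj] using hasDerivAt_const s (0 : ℝ)
  have h2 := ((hψ.differentiable (by simp)) (y + Pi.single i s)).hasFDerivAt.comp_hasDerivAt s h1
  simpa only [Function.comp_def, proj_add] using h2

lemma IsSmooth.partialDeriv_proj {d : ℕ} {ψ : Torus d → ℝ} (hψ : IsSmooth ψ) (i : Fin d)
    (y : Fin d → ℝ) :
    partialDeriv i ψ (proj y) = fderiv ℝ (fun y => ψ (proj y)) y (Pi.single i 1) := by
  simpa [partialDeriv] using (hψ.hasDerivAt i y 0).deriv

lemma IsSmooth.hasDerivAt_partialDeriv {d : ℕ} {ψ : Torus d → ℝ} (hψ : IsSmooth ψ) (i : Fin d)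
    (t : Torus d) (s : ℝ) :
    HasDerivAt (fun s : ℝ => ψ (t + proj (Pi.single i s)))
      (partialDeriv i ψ (t + proj (Pi.single i s))) s := by
  obtain ⟨y, rfl⟩ := isOpenQuotientMap_proj.surjective t
  rw [← proj_add, hψ.partialDeriv_proj]
  exact hψ.hasDerivAt i y s

lemma IsSmooth.continuous {d : ℕ} {ψ : Torus d → ℝ} (hψ : IsSmooth ψ) : Continuous ψ :=
  isOpenQuotientMap_proj.continuous_comp_iff.1 (ContDiff.continuous hψ)

lemma IsSmooth.continuous_partialDeriv {d : ℕ} {ψ : Torus d → ℝ} (hψ : IsSmooth ψ) (i : Fin d) :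
    Continuous (partialDeriv i ψ) := by
  refine isOpenQuotientMap_proj.continuous_comp_iff.1 ?_
  have : partialDeriv i ψ ∘ proj =
      fun y => fderiv ℝ (fun y => ψ (proj y)) y (Pi.single i 1) :=
    funext fun y => hψ.partialDeriv_proj i y
  rw [this]
  exact (ContDiff.continuous_fderiv hψ (by simp)).clm_apply continuous_const

lemma memLp_of_continuous {d : ℕ} {f : Torus d → ℝ} (hf : Continuous f) (p : ENNReal) :
    MemLp f p (haar d) := by
  obtain ⟨C, hC⟩ := isCompact_univ.exists_bound_of_continuousOn hf.continuousOn
  exact MemLp.of_bound hf.aestronglyMeasurable C (.of_forall fun t => hC t (Set.mem_univ t))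

lemma IsSmooth.comp_add_right {d : ℕ} {ψ : Torus d → ℝ} (hψ : IsSmooth ψ) (s : Torus d) :
    IsSmooth fun t => ψ (t + s) := by
  obtain ⟨y, rfl⟩ := isOpenQuotientMap_proj.surjective s
  simp only [IsSmooth, ← proj_add]
  exact ContDiff.comp (g := fun y => ψ (proj y)) hψ (contDiff_id.add contDiff_const)

lemma partialDeriv_comp_add_right {d : ℕ} (i : Fin d) (ψ : Torus d → ℝ) (s t : Torus d) :
    partialDeriv i (fun t => ψ (t + s)) t = partialDeriv i ψ (t + s) := by
  simp only [partialDeriv, add_right_comm]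

/-- By translation invariance `∫ ψ(t + s eᵢ)` is constant in `s`; differentiate under the integral
at `s = 0`. -/
lemma IsSmooth.integral_partialDeriv {d : ℕ} {ψ : Torus d → ℝ} (hψ : IsSmooth ψ) (i : Fin d) :
    ∫ t, partialDeriv i ψ t ∂(haar d) = 0 := by
  obtain ⟨C, hC⟩ := isCompact_univ.exists_bound_of_continuousOn
    (hψ.continuous_partialDeriv i).continuousOn
  have h := (hasDerivAt_integral_of_dominated_loc_of_deriv_le (μ := haar d) (x₀ := (0 : ℝ))
    (F := fun s t => ψ (t + proj (Pi.single i s)))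
    (F' := fun s t => partialDeriv i ψ (t + proj (Pi.single i s))) (bound := fun _ => C)
    Filter.univ_mem
    (.of_forall fun s => (hψ.continuous.comp (continuous_add_const _)).aestronglyMeasurable)
    ((memLp_of_continuous (hψ.continuous.comp (continuous_add_const _)) 1).integrable le_rfl)
    ((hψ.continuous_partialDeriv i).comp (continuous_add_const _)).aestronglyMeasurable
    (.of_forall fun t s _ => hC _ (Set.mem_univ _)) (integrable_const C)
    (.of_forall fun t s _ => hψ.hasDerivAt_partialDeriv i t s)).2
  simp only [integral_add_right_eq_self] at h
  exact h.unique (hasDerivAt_const _ _)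

/-! ### Weak gradients. -/

namespace HasWeakGradient

variable {d : ℕ} {v w : Torus d → ℝ} {g h : Fin d → Torus d → ℝ}

lemma sub (hw : HasWeakGradient w g) (hv : HasWeakGradient v h) :
    HasWeakGradient (fun t => w t - v t) fun i t => g i t - h i t where
  memLp := hw.memLp.sub hv.memLp
  memLp_grad i := (hw.memLp_grad i).sub (hv.memLp_grad i)
  integral_eq ψ hψ i := by
    have h1 := memLp_of_continuous hψ.continuous 2
    have h2 := memLp_of_continuous (hψ.continuous_partialDeriv i) 2
    have e1 := integral_sub (hw.memLp.integrable_mul h2) (hv.memLp.integrable_mul h2)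
    have e2 := integral_sub ((hw.memLp_grad i).integrable_mul h1)
      ((hv.memLp_grad i).integrable_mul h1)
    simp only [Pi.mul_apply] at e1 e2
    simp only [sub_mul]
    rw [e1, e2, hw.integral_eq ψ hψ, hv.integral_eq ψ hψ]
    ring

lemma const (c : ℝ) : HasWeakGradient (fun _ : Torus d => c) fun _ _ => 0 where
  memLp := memLp_const c
  memLp_grad _ := memLp_const 0
  integral_eq ψ hψ i := by
    simp [integral_const_mul, hψ.integral_partialDeriv]

lemma congr_ae (hw : HasWeakGradient w g) (hwv : w =ᵐ[haar d] v)
    (hgh : ∀ i, g i =ᵐ[haar d] h i) : HasWeakGradient v h where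
  memLp := (memLp_congr_ae hwv).1 hw.memLp
  memLp_grad i := (memLp_congr_ae (hgh i)).1 (hw.memLp_grad i)
  integral_eq ψ hψ i := by
    have e1 := integral_congr_ae (hwv.mul (.refl _ (partialDeriv i ψ)))
    have e2 := integral_congr_ae ((hgh i).mul (.refl _ ψ))
    simp only [Pi.mul_apply] at e1 e2
    rw [← e1, ← e2]
    exact hw.integral_eq ψ hψ i

/-- Test the original identity against `ψ(· - s)` and change variables. -/
lemma comp_add_right (hw : HasWeakGradient w g) (s : Torus d) :
    HasWeakGradient (fun t => w (t + s)) fun i t => g i (t + s) where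
  memLp := hw.memLp.comp_measurePreserving (measurePreserving_add_right (haar d) s)
  memLp_grad i := (hw.memLp_grad i).comp_measurePreserving (measurePreserving_add_right (haar d) s)
  integral_eq ψ hψ i := by
    have := hw.integral_eq _ (hψ.comp_add_right (-s)) i
    rw [← integral_add_right_eq_self _ s, ← integral_add_right_eq_self (fun t => g i t * _) s]
      at this
    simpa [partialDeriv_comp_add_right] using this

end HasWeakGradient
-- Fourier coefficients and the Poincaré inequality.
open UnitAddTorus

lemma mFourier_proj {d : ℕ} (n : Fin d → ℤ) (y : Fin d → ℝ) :
    mFourier n (proj y) = ∏ i, Complex.exp (2 * Real.pi * Complex.I * n i * y i) := by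
  simp [mFourier, proj]

lemma mFourier_add_apply {d : ℕ} (n : Fin d → ℤ) (s t : Torus d) :
    mFourier n (s + t) = mFourier n s * mFourier n t := by
  simp [mFourier, fourier_apply, Finset.prod_mul_distrib, smul_add, AddCircle.toCircle_add]

lemma contDiff_mFourier_proj {d : ℕ} (n : Fin d → ℤ) :
    ContDiff ℝ ∞ fun y : Fin d → ℝ => mFourier n (proj y) := by
  simp only [mFourier_proj]
  refine contDiff_prod fun i _ => ContDiff.cexp (contDiff_const.mul ?_)
  exact Complex.ofRealCLM.contDiff.comp (contDiff_apply ℝ ℝ i)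

lemma isSmooth_re_mFourier {d : ℕ} (n : Fin d → ℤ) : IsSmooth fun t => (mFourier n t).re :=
  Complex.reCLM.contDiff.comp (contDiff_mFourier_proj n)

lemma isSmooth_im_mFourier {d : ℕ} (n : Fin d → ℤ) : IsSmooth fun t => (mFourier n t).im :=
  Complex.imCLM.contDiff.comp (contDiff_mFourier_proj n)

/-- `mFourier n` is a character, so a shift along `eᵢ` only multiplies it by an exponential. -/
lemma hasDerivAt_mFourier {d : ℕ} (n : Fin d → ℤ) (i : Fin d) (t : Torus d) :
    HasDerivAt (fun s : ℝ => mFourier n (t + proj (Pi.single i s)))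
      (mFourier n t * (2 * Real.pi * n i * Complex.I)) 0 := by
  have h1 : ∀ s : ℝ, mFourier n (t + proj (Pi.single i s)) =
      mFourier n t * Complex.exp (2 * Real.pi * Complex.I * n i * s) := by
    intro s
    rw [mFourier_add_apply, mFourier_proj]
    congr 1
    rw [Finset.prod_eq_single i (fun j _ hj => by simp [hj]) (by simp)]
    simp
  simp only [h1]
  have h2 : HasDerivAt (fun s : ℝ => Complex.exp (2 * Real.pi * Complex.I * n i * s))
      (2 * Real.pi * n i * Complex.I) 0 := by
    have := ((Complex.ofRealCLM.hasDerivAt (x := (0 : ℝ))).const_mul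
      (2 * Real.pi * Complex.I * n i)).cexp
    refine this.congr_deriv ?_
    simp; ring
  exact h2.const_mul _

lemma partialDeriv_re_mFourier {d : ℕ} (n : Fin d → ℤ) (i : Fin d) (t : Torus d) :
    partialDeriv i (fun t => (mFourier n t).re) t = -(2 * Real.pi * n i) * (mFourier n t).im := by
  refine (Complex.reCLM.hasFDerivAt.comp_hasDerivAt (0 : ℝ)
    (hasDerivAt_mFourier n i t)).deriv.trans ?_
  simp; ring

lemma partialDeriv_im_mFourier {d : ℕ} (n : Fin d → ℤ) (i : Fin d) (t : Torus d) :
    partialDeriv i (fun t => (mFourier n t).im) t = 2 * Real.pi * n i * (mFourier n t).re := by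
  refine (Complex.imCLM.hasFDerivAt.comp_hasDerivAt (0 : ℝ)
    (hasDerivAt_mFourier n i t)).deriv.trans ?_
  simp; ring

/-- The real and imaginary parts of the Fourier coefficients of a real function. -/
lemma mFourierCoeff_ofReal {d : ℕ} {w : Torus d → ℝ} (hw : MemLp w 2 (haar d)) (n : Fin d → ℤ) :
    mFourierCoeff (fun t => (w t : ℂ)) n =
      ⟨∫ t, w t * (mFourier (-n) t).re ∂(haar d), ∫ t, w t * (mFourier (-n) t).im ∂(haar d)⟩ := by
  have hi : Integrable (fun t => mFourier (-n) t • (w t : ℂ)) (haar d) := by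
    have := (hw.integrable one_le_two).ofReal (𝕜 := ℂ)
    refine this.bdd_mul (c := 1) (map_continuous _).aestronglyMeasurable (.of_forall fun t => ?_)
    simpa only [mFourier_norm] using (mFourier (-n)).norm_coe_le_norm t
  have h1 : mFourierCoeff (fun t => (w t : ℂ)) n = ∫ t, mFourier (-n) t • (w t : ℂ) ∂(haar d) :=
    rfl
  rw [h1]
  apply Complex.ext
  · rw [← RCLike.re_eq_complex_re, ← integral_re hi]
    simp [mul_comm]
  · rw [← RCLike.im_eq_complex_im, ← integral_im hi]
    simp [mul_comm]

/-- Weak gradients are tested against real functions only, so the real and imaginary parts of the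
character serve as separate test functions. -/
lemma HasWeakGradient.mFourierCoeff_grad {d : ℕ} {w : Torus d → ℝ} {g : Fin d → Torus d → ℝ}
    (hw : HasWeakGradient w g) (i : Fin d) (n : Fin d → ℤ) :
    mFourierCoeff (fun t => (g i t : ℂ)) n =
      2 * Real.pi * n i * Complex.I * mFourierCoeff (fun t => (w t : ℂ)) n := by
  have h1 := hw.integral_eq _ (isSmooth_re_mFourier (-n)) i
  have h2 := hw.integral_eq _ (isSmooth_im_mFourier (-n)) i
  simp only [partialDeriv_re_mFourier, partialDeriv_im_mFourier, Pi.neg_apply, Int.cast_neg,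
    mul_left_comm (w _), integral_const_mul] at h1 h2
  rw [mFourierCoeff_ofReal hw.memLp, mFourierCoeff_ofReal (hw.memLp_grad i)]
  apply Complex.ext
  · simp; linarith
  · simp; linarith

lemma hasSum_sq_mFourierCoeff_ofReal {d : ℕ} {w : Torus d → ℝ} (hw : MemLp w 2 (haar d)) :
    HasSum (fun n => ‖mFourierCoeff (fun t => (w t : ℂ)) n‖ ^ 2) (∫ t, w t ^ 2 ∂(haar d)) := by
  have hw' : MemLp (fun t => (w t : ℂ)) 2 (haar d) := hw.ofReal
  have hae := hw'.coeFn_toLp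
  have h := hasSum_sq_mFourierCoeff (hw'.toLp _)
  have e1 : ∀ n, mFourierCoeff (hw'.toLp _) n = mFourierCoeff (fun t => (w t : ℂ)) n := fun n =>
    integral_congr_ae (hae.mono fun t ht => by simp only [ht])
  suffices e2 : ∫ t, ‖hw'.toLp _ t‖ ^ 2 ∂(haar d) = ∫ t, w t ^ 2 ∂(haar d) by
    rw [← e2]
    exact h.congr_fun fun n => by rw [← e1 n]; rfl
  refine integral_congr_ae (hae.mono fun t ht => ?_)
  simp [ht]

/-- The Poincaré inequality on the torus. -/
theorem HasWeakGradient.poincare {d : ℕ} {w : Torus d → ℝ} {g : Fin d → Torus d → ℝ}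
    (hw : HasWeakGradient w g) (h0 : ∫ t, w t ∂(haar d) = 0) :
    ∫ t, w t ^ 2 ∂(haar d) ≤ ∑ i, ∫ t, g i t ^ 2 ∂(haar d) := by
  refine hasSum_le (fun n => ?_) (hasSum_sq_mFourierCoeff_ofReal hw.memLp)
    (hasSum_sum fun i _ => hasSum_sq_mFourierCoeff_ofReal (hw.memLp_grad i))
  by_cases hn : n = 0
  · subst hn
    have : mFourierCoeff (fun t => (w t : ℂ)) 0 = 0 := by
      rw [mFourierCoeff_ofReal hw.memLp]
      simp [mFourier_zero, h0]
      rfl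
    rw [this]
    simp only [norm_zero, ne_eq, OfNat.ofNat_ne_zero, not_false_eq_true, zero_pow]
    positivity
  -- For `n ≠ 0` a single gradient component suffices: if `n i ≠ 0`, its coefficient carries the
  -- factor `|2π n i| ≥ 1`.
  · obtain ⟨i, hi⟩ := Function.ne_iff.1 hn
    refine le_trans ?_ (Finset.single_le_sum (fun j _ => sq_nonneg
      ‖mFourierCoeff (fun t => (g j t : ℂ)) n‖) (Finset.mem_univ i))
    rw [hw.mFourierCoeff_grad i n]
    gcongr
    rw [norm_mul]
    refine le_mul_of_one_le_left (norm_nonneg _) ?_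
    have h1 : (1 : ℝ) ≤ |(n i : ℝ)| := by exact_mod_cast Int.one_le_abs hi
    have h2 := Real.pi_gt_three
    simp [abs_of_pos Real.pi_pos]
    nlinarith


/-! ### The Hilbert space of the cell problem. -/

lemma integrable_continuous_mul_mul {d : ℕ} {f u v : Torus d → ℝ} (hf : Continuous f)
    (hu : MemLp u 2 (haar d)) (hv : MemLp v 2 (haar d)) :
    Integrable (fun t => f t * u t * v t) (haar d) := by
  have h : MemLp (fun t => f t * u t) 2 (haar d) := hu.mul (memLp_of_continuous hf ⊤)
  exact h.integrable_mul hv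

/-- Multiplication by a continuous function, as an operator on `L²` of the torus. -/
noncomputable def mulL2 {d : ℕ} {f : Torus d → ℝ} (hf : Continuous f) :
    Lp ℝ 2 (haar d) →L[ℝ] Lp ℝ 2 (haar d) :=
  (ContinuousLinearMap.mul ℝ ℝ).holderL (haar d) ⊤ 2 2 ((memLp_of_continuous hf ⊤).toLp f)

lemma inner_mulL2 {d : ℕ} {f : Torus d → ℝ} (hf : Continuous f) (u v : Lp ℝ 2 (haar d)) :
    inner ℝ (mulL2 hf u) v = ∫ t, f t * u t * v t ∂(haar d) := by
  rw [L2.inner_def]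
  refine integral_congr_ae ?_
  filter_upwards [(ContinuousLinearMap.mul ℝ ℝ).coeFn_holder (r := 2)
    ((memLp_of_continuous hf ⊤).toLp f) u, (memLp_of_continuous hf ⊤).coeFn_toLp] with t h1 h2
  simp only [mulL2, ContinuousLinearMap.holderL_apply_apply, h1, h2, ContinuousLinearMap.mul_apply']
  simp [mul_comm]

lemma inner_toLp {d : ℕ} {f : Torus d → ℝ} (hf : MemLp f 2 (haar d)) (u : Lp ℝ 2 (haar d)) :
    inner ℝ (hf.toLp f) u = ∫ t, u t * f t ∂(haar d) := by
  rw [L2.inner_def]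
  refine integral_congr_ae ?_
  filter_upwards [hf.coeFn_toLp] with t h1
  simp [h1]

lemma norm_sq_toLp {d : ℕ} (u : Lp ℝ 2 (haar d)) : ‖u‖ ^ 2 = ∫ t, u t ^ 2 ∂(haar d) := by
  rw [← real_inner_self_eq_norm_sq, L2.inner_def]
  simp [pow_two]

/-- Pairs of a function and a vector field in `L²`. -/
abbrev JetL2 (d : ℕ) : Type := PiLp 2 fun _ : Option (Fin d) => Lp ℝ 2 (haar d)

/-- The Sobolev space of mean zero functions in `H¹(𝕋^d)`, inside the space of jets. -/
noncomputable def sobolev (d : ℕ) : Submodule ℝ (JetL2 d) :=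
  (⨅ (ψ : {ψ : Torus d → ℝ // IsSmooth ψ}) (i : Fin d),
    (innerSL ℝ ((memLp_of_continuous (ψ.2.continuous_partialDeriv i) 2).toLp _) ∘L
        PiLp.proj 2 (fun _ : Option (Fin d) => Lp ℝ 2 (haar d)) none +
      innerSL ℝ ((memLp_of_continuous ψ.2.continuous 2).toLp _) ∘L
        PiLp.proj 2 (fun _ : Option (Fin d) => Lp ℝ 2 (haar d)) (some i)).ker) ⊓
  (innerSL ℝ ((memLp_const (μ := haar d) (1 : ℝ)).toLp _) ∘L
    PiLp.proj 2 (fun _ : Option (Fin d) => Lp ℝ 2 (haar d)) none).ker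

/-- The weak gradient and mean zero conditions are kernels of continuous functionals. Closedness
gives the completeness that Lax–Milgram needs. -/
lemma isClosed_sobolev (d : ℕ) : IsClosed (sobolev d : Set (JetL2 d)) := by
  unfold sobolev
  rw [Submodule.coe_inf, Submodule.coe_iInf]
  refine (isClosed_iInter fun ψ => ?_).inter (ContinuousLinearMap.isClosed_ker _)
  rw [Submodule.coe_iInf]
  exact isClosed_iInter fun i => ContinuousLinearMap.isClosed_ker _

instance sobolev.completeSpace (d : ℕ) : CompleteSpace (sobolev d) :=
  (isClosed_sobolev d).completeSpace_coe

lemma mem_sobolev {d : ℕ} {u : JetL2 d} :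
    u ∈ sobolev d ↔ HasWeakGradient (u none) (fun i => u (some i)) ∧
      ∫ t, u none t ∂(haar d) = 0 := by
  simp only [sobolev, Submodule.mem_inf, Submodule.mem_iInf, LinearMap.mem_ker,
    ContinuousLinearMap.coe_coe, add_apply, ContinuousLinearMap.comp_apply,
    PiLp.proj_apply, innerSL_apply_apply, inner_toLp, mul_one, Subtype.forall]
  refine and_congr_left fun _ => ⟨fun h => ⟨Lp.memLp _, fun i => Lp.memLp _, fun ψ hψ i => ?_⟩,
    fun h ψ hψ i => ?_⟩
  · exact eq_neg_of_add_eq_zero_left (h ψ hψ i)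
  · rw [h.integral_eq ψ hψ i, neg_add_cancel]

/-- Evaluation of a component of a jet in the Sobolev space. -/
noncomputable def sobolevProj {d : ℕ} (o : Option (Fin d)) : sobolev d →L[ℝ] Lp ℝ 2 (haar d) :=
  PiLp.proj 2 (fun _ : Option (Fin d) => Lp ℝ 2 (haar d)) o ∘L (sobolev d).subtypeL

lemma sobolevProj_apply {d : ℕ} (o : Option (Fin d)) (u : sobolev d) :
    sobolevProj o u = (u : JetL2 d) o := rfl

/-- The bilinear form `∫ ⟨a ∇u, ∇v⟩`. -/
noncomputable def cellForm {d : ℕ} {a : Torus d → Matrix (Fin d) (Fin d) ℝ}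
    (ha : ∀ k l, Continuous fun t => a t k l) : sobolev d →L[ℝ] sobolev d →L[ℝ] ℝ :=
  ∑ k, ∑ l, (innerSL ℝ).bilinearComp (mulL2 (ha k l) ∘L sobolevProj (some l))
    (sobolevProj (some k))

/-! ### The cell problem: existence, uniqueness and translation of correctors. -/

section
variable {d : ℕ} {a : Torus d → Matrix (Fin d) (Fin d) ℝ}

lemma integral_flux (ha : ∀ k l, Continuous fun t => a t k l)
    {g h : Fin d → Torus d → ℝ} (hg : ∀ i, MemLp (g i) 2 (haar d))
    (hh : ∀ i, MemLp (h i) 2 (haar d)) :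
    Integrable (fun t => ∑ k, (∑ l, a t k l * g l t) * h k t) (haar d) ∧
    ∫ t, ∑ k, (∑ l, a t k l * g l t) * h k t ∂(haar d) =
      ∑ k, ∑ l, ∫ t, a t k l * g l t * h k t ∂(haar d) := by
  simp only [Finset.sum_mul]
  have hi k l := integrable_continuous_mul_mul (ha k l) (hg l) (hh k)
  refine ⟨integrable_finsetSum _ fun k _ => integrable_finsetSum _ fun l _ => hi k l, ?_⟩
  rw [integral_finsetSum _ fun k _ => integrable_finsetSum _ fun l _ => hi k l]
  exact Finset.sum_congr rfl fun k _ => integral_finsetSum _ fun l _ => hi k l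

lemma cellForm_apply (ha : ∀ k l, Continuous fun t => a t k l) (u v : sobolev d) :
    cellForm ha u v = ∫ t, ∑ k, (∑ l, a t k l * (u : JetL2 d) (some l) t) *
      (v : JetL2 d) (some k) t ∂(haar d) := by
  rw [(integral_flux ha (fun i => Lp.memLp _) fun i => Lp.memLp _).2]
  simp [cellForm, inner_mulL2, sobolevProj_apply]

/-- The energy controls the Dirichlet integral. -/
lemma le_integral_flux (ha : ∀ k l, Continuous fun t => a t k l) {r : ℝ}
    (hell : ∀ t, ∀ ξ : Fin d → ℝ, r * dotProduct ξ ξ ≤ dotProduct ((a t).mulVec ξ) ξ)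
    {g : Fin d → Torus d → ℝ} (hg : ∀ i, MemLp (g i) 2 (haar d)) :
    r * ∑ i, ∫ t, g i t ^ 2 ∂(haar d) ≤
      ∫ t, ∑ k, (∑ l, a t k l * g l t) * g k t ∂(haar d) := by
  rw [← integral_finsetSum _ fun i _ => (hg i).integrable_sq, ← integral_const_mul]
  refine integral_mono ((integrable_finsetSum _ fun i _ => (hg i).integrable_sq).const_mul r)
    (integral_flux ha hg hg).1 fun t => ?_
  simpa [dotProduct, Matrix.mulVec, pow_two] using hell t fun i => g i t

lemma isCoercive_cellForm (ha : ∀ k l, Continuous fun t => a t k l) {r : ℝ} (hr : 0 < r)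
    (hell : ∀ t, ∀ ξ : Fin d → ℝ, r * dotProduct ξ ξ ≤ dotProduct ((a t).mulVec ξ) ξ) :
    IsCoercive (cellForm ha) := by
  -- By Poincaré `‖u‖²` is at most twice the Dirichlet integral, hence the constant `r / 2`.
  refine ⟨r / 2, half_pos hr, fun u => ?_⟩
  obtain ⟨hu, h0⟩ := mem_sobolev.1 u.2
  rw [cellForm_apply]
  refine le_trans ?_ (le_integral_flux ha hell hu.memLp_grad)
  have h1 : ‖u‖ ^ 2 = ∫ t, (u : JetL2 d) none t ^ 2 ∂(haar d) +
      ∑ i, ∫ t, (u : JetL2 d) (some i) t ^ 2 ∂(haar d) := by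
    rw [Submodule.coe_norm, PiLp.norm_sq_eq_of_L2, Fintype.sum_option]
    simp only [norm_sq_toLp]
  have h2 := hu.poincare h0
  rw [mul_assoc, ← pow_two, h1]
  nlinarith

lemma mul_transpose_apply_eq (G b : Matrix (Fin d) (Fin d) ℝ) (j k : Fin d) :
    (G * b.transpose) j k = ∑ l, b k l * G j l := by
  simp [Matrix.mul_apply, mul_comm]

/-- Existence of a solution of the cell problem for one component, by Lax–Milgram. -/
lemma exists_corrector_component (ha : ∀ k l, Continuous fun t => a t k l) {r : ℝ} (hr : 0 < r)
    (hell : ∀ t, ∀ ξ : Fin d → ℝ, r * dotProduct ξ ξ ≤ dotProduct ((a t).mulVec ξ) ξ)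
    (j : Fin d) :
    ∃ (w : Torus d → ℝ) (g : Fin d → Torus d → ℝ), HasWeakGradient w g ∧
      ∀ (v : Torus d → ℝ) (h : Fin d → Torus d → ℝ), HasWeakGradient v h →
        ∫ t, ∑ k, (∑ l, a t k l * g l t) * h k t ∂(haar d) =
          -∫ t, ∑ k, a t k j * h k t ∂(haar d) := by
  have hco := isCoercive_cellForm ha hr hell
  let F : sobolev d →L[ℝ] ℝ :=
    -∑ k, innerSL ℝ ((memLp_of_continuous (ha k j) 2).toLp _) ∘L sobolevProj (some k)
  obtain ⟨u, hu⟩ := hco.continuousLinearEquivOfBilin.surjective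
    ((InnerProductSpace.toDual ℝ (sobolev d)).symm F)
  have key : ∀ v : sobolev d, cellForm ha u v = F v := fun v => by
    rw [← hco.continuousLinearEquivOfBilin_apply, hu, InnerProductSpace.toDual_symm_apply]
  refine ⟨(u : JetL2 d) none, fun i => (u : JetL2 d) (some i), (mem_sobolev.1 u.2).1,
    fun v h hv => ?_⟩
  -- Lax–Milgram only gives mean zero test functions. Subtracting the mean of `v` leaves its
  -- gradient, and so both sides of the equation, unchanged.
  have hv' := hv.sub (HasWeakGradient.const (∫ t, v t ∂(haar d)))
  simp only [sub_zero] at hv'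
  let V : JetL2 d := WithLp.toLp 2 fun o => match o with
    | none => hv'.memLp.toLp
    | some i => (hv.memLp_grad i).toLp
  have hVn : V none =ᵐ[haar d] _ := hv'.memLp.coeFn_toLp
  have hVs i : V (some i) =ᵐ[haar d] h i := (hv.memLp_grad i).coeFn_toLp
  have hV : V ∈ sobolev d := by
    refine mem_sobolev.2 ⟨hv'.congr_ae hVn.symm fun i => (hVs i).symm, ?_⟩
    rw [integral_congr_ae hVn,
      integral_sub (hv.memLp.integrable one_le_two) (integrable_const _)]
    simp
  have hk := key ⟨V, hV⟩
  have hF : F ⟨V, hV⟩ = -∫ t, ∑ k, a t k j * V (some k) t ∂(haar d) := by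
    have hi k : Integrable (fun t => a t k j * V (some k) t) (haar d) :=
      (memLp_of_continuous (ha k j) 2).integrable_mul (Lp.memLp (V (some k)))
    rw [integral_finsetSum _ fun k _ => hi k]
    simp [F, inner_toLp, sobolevProj_apply, mul_comm]
  rw [hF, cellForm_apply] at hk
  have hae := Filter.eventually_all.2 hVs
  calc _ = _ := integral_congr_ae (hae.mono fun t ht => by simp only [ht])
    _ = _ := hk
    _ = _ := congrArg Neg.neg (integral_congr_ae (hae.mono fun t ht => by simp only [ht]))

theorem exists_isCorrector (ha : ∀ k l, Continuous fun t => a t k l) {r : ℝ} (hr : 0 < r)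
    (hell : ∀ t, ∀ ξ : Fin d → ℝ, r * dotProduct ξ ξ ≤ dotProduct ((a t).mulVec ξ) ξ) :
    ∃ χ G, IsCorrector a χ G := by
  choose w g hw hg using exists_corrector_component ha hr hell
  refine ⟨fun t j => w j t, fun t => Matrix.of fun j k => g j k t, hw, fun j v h hv => ?_⟩
  simpa only [mul_transpose_apply_eq, Matrix.of_apply, Matrix.transpose_apply] using hg j v h hv

/-- Subtract the two equations and test with the difference of the correctors: its energy is zero,
so by ellipticity its gradient vanishes almost everywhere. -/
theorem IsCorrector.grad_ae_eq (ha : ∀ k l, Continuous fun t => a t k l) {r : ℝ} (hr : 0 < r)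
    (hell : ∀ t, ∀ ξ : Fin d → ℝ, r * dotProduct ξ ξ ≤ dotProduct ((a t).mulVec ξ) ξ)
    {χ χ' : Torus d → Fin d → ℝ} {G G' : Torus d → Matrix (Fin d) (Fin d) ℝ}
    (h : IsCorrector a χ G) (h' : IsCorrector a χ' G') : G =ᵐ[haar d] G' := by
  have key : ∀ j k, ∀ᵐ t ∂(haar d), G t j k = G' t j k := by
    intro j
    have hs := (h.grad j).sub (h'.grad j)
    have e1 := h.weak j _ _ hs
    rw [← h'.weak j _ _ hs] at e1
    simp only [mul_transpose_apply_eq] at e1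
    have e2 := sub_eq_zero.2 e1
    rw [← integral_sub (integral_flux ha (h.grad j).memLp_grad hs.memLp_grad).1
      (integral_flux ha (h'.grad j).memLp_grad hs.memLp_grad).1] at e2
    simp only [← Finset.sum_sub_distrib, ← sub_mul, ← mul_sub] at e2
    have e3 := le_integral_flux ha hell hs.memLp_grad
    rw [e2] at e3
    have hnn : ∀ k ∈ Finset.univ, 0 ≤ ∫ t, (G t j k - G' t j k) ^ 2 ∂(haar d) :=
      fun k _ => integral_nonneg fun t => sq_nonneg _
    have e4 := (Finset.sum_eq_zero_iff_of_nonneg hnn).1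
      (le_antisymm (nonpos_of_mul_nonpos_right e3 hr) (Finset.sum_nonneg hnn))
    intro k
    have e5 := (integral_eq_zero_iff_of_nonneg (fun t => sq_nonneg _)
      (hs.memLp_grad k).integrable_sq).1 (e4 k (Finset.mem_univ k))
    filter_upwards [e5] with t ht
    exact sub_eq_zero.1 (pow_eq_zero_iff two_ne_zero |>.1 ht)
  filter_upwards [Filter.eventually_all.2 fun j => Filter.eventually_all.2 (key j)] with t ht
  exact Matrix.ext ht

theorem IsCorrector.cellAverage_eq (ha : ∀ k l, Continuous fun t => a t k l) {r : ℝ} (hr : 0 < r)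
    (hell : ∀ t, ∀ ξ : Fin d → ℝ, r * dotProduct ξ ξ ≤ dotProduct ((a t).mulVec ξ) ξ)
    {χ χ' : Torus d → Fin d → ℝ} {G G' : Torus d → Matrix (Fin d) (Fin d) ℝ}
    (h : IsCorrector a χ G) (h' : IsCorrector a χ' G') : cellAverage a G = cellAverage a G' := by
  ext i j
  exact integral_congr_ae ((h.grad_ae_eq ha hr hell h').mono fun t ht => by simp only [ht])

theorem homogenize_eq {A : TwoScale d} {x : Fin d → ℝ} (ha : ∀ k l, Continuous fun t => A x t k l)
    {r : ℝ} (hr : 0 < r)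
    (hell : ∀ t, ∀ ξ : Fin d → ℝ, r * dotProduct ξ ξ ≤ dotProduct ((A x t).mulVec ξ) ξ)
    {χ : Torus d → Fin d → ℝ} {G : Torus d → Matrix (Fin d) (Fin d) ℝ}
    (h : IsCorrector (A x) χ G) : homogenize A x = cellAverage (A x) G := by
  have hex : ∃ G, ∃ χ, IsCorrector (A x) χ G := ⟨G, χ, h⟩
  rw [homogenize, dif_pos hex]
  exact hex.choose_spec.choose_spec.cellAverage_eq ha hr hell h

/-- Correctors of translated coefficients are translated correctors. -/
theorem IsCorrector.comp_add_right {χ : Torus d → Fin d → ℝ}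
    {G : Torus d → Matrix (Fin d) (Fin d) ℝ} (h : IsCorrector a χ G) (s : Torus d) :
    IsCorrector (fun t => a (t + s)) (fun t => χ (t + s)) fun t => G (t + s) where
  grad j := (h.grad j).comp_add_right s
  weak j v w hv := by
    have := h.weak j _ _ (hv.comp_add_right (-s))
    rw [← integral_add_right_eq_self
        (fun t => ∑ k, (G t * (a t).transpose) j k * w k (t + -s)) s,
      ← integral_add_right_eq_self (fun t => ∑ k, (a t).transpose j k * w k (t + -s)) s] at this
    simpa using this

theorem isCorrector_comp_add_right_iff {χ : Torus d → Fin d → ℝ}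
    {G : Torus d → Matrix (Fin d) (Fin d) ℝ} (s : Torus d) :
    IsCorrector a χ G ↔
      IsCorrector (fun t => a (t + s)) (fun t => χ (t + s)) fun t => G (t + s) :=
  ⟨fun h => h.comp_add_right s, fun h => by simpa using h.comp_add_right (-s)⟩

lemma cellAverage_comp_add_right (G : Torus d → Matrix (Fin d) (Fin d) ℝ) (s : Torus d) :
    cellAverage (fun t => a (t + s)) (fun t => G (t + s)) = cellAverage a G := by
  ext i j
  exact integral_add_right_eq_self (fun t => (a t + a t * (G t).transpose) i j) s

end

/-! ### Regularity of the coefficient on `Ω × 𝕋^d`. -/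

section
variable {d : ℕ} {A : TwoScale d}

lemma isCompact_Omega (d : ℕ) : IsCompact (Omega d) := isCompact_Icc

lemma measurableSet_Omega (d : ℕ) : MeasurableSet (Omega d) := (isCompact_Omega d).measurableSet

/-- `IsC1` speaks of the lift. Its domain is the full preimage of `Ω × 𝕋^d` under the open quotient
map `id × proj`, so neighbourhoods within it push forward and continuity descends. -/
lemma IsC1.continuousOn (hA : IsC1 A) (i j : Fin d) :
    ContinuousOn (fun p : (Fin d → ℝ) × Torus d => A p.1 p.2 i j) (Omega d ×ˢ Set.univ) := by
  have hq : IsOpenQuotientMap (Prod.map id proj : (Fin d → ℝ) × (Fin d → ℝ) → _ × Torus d) :=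
    IsOpenQuotientMap.id.prodMap isOpenQuotientMap_proj
  have hc := (hA i j).continuousOn
  rintro ⟨x, t⟩ hx
  obtain ⟨y, rfl⟩ := isOpenQuotientMap_proj.surjective t
  have hp := hc (x, y) ⟨hx.1, Set.mem_univ _⟩
  rw [ContinuousWithinAt] at hp ⊢
  have hm : nhdsWithin (x, proj y) (Omega d ×ˢ Set.univ) =
      Filter.map (Prod.map id proj) (nhdsWithin (x, y) (Omega d ×ˢ Set.univ)) := by
    have h1 := hq.map_nhds_eq (x, y)
    have h2 : Omega d ×ˢ (Set.univ : Set (Fin d → ℝ)) =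
        Prod.map id proj ⁻¹' (Omega d ×ˢ (Set.univ : Set (Torus d))) := by ext; simp
    rw [nhdsWithin, nhdsWithin, h2, Filter.map_inf_principal_preimage, h1]
    rfl
  rw [hm]
  exact Filter.tendsto_map'_iff.2 hp

lemma IsC1.continuous_apply (hA : IsC1 A) {x : Fin d → ℝ} (hx : x ∈ Omega d) (i j : Fin d) :
    Continuous fun t => A x t i j :=
  (hA.continuousOn i j).comp_continuous (Continuous.prodMk_right x) fun _ => ⟨hx, Set.mem_univ _⟩

lemma IsC1.exists_bound (hA : IsC1 A) (i j : Fin d) :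
    ∃ C, ∀ x ∈ Omega d, ∀ t, ‖A x t i j‖ ≤ C := by
  obtain ⟨C, hC⟩ := ((isCompact_Omega d).prod isCompact_univ).exists_bound_of_continuousOn
    (hA.continuousOn i j)
  exact ⟨C, fun x hx t => hC (x, t) ⟨hx, Set.mem_univ _⟩⟩

/-- Nothing is known about `A` outside `Ω`, so it is cut off there before it is composed with
measurable maps. -/
lemma IsC1.measurable_indicator (hA : IsC1 A) (i j : Fin d) :
    Measurable ((Omega d ×ˢ Set.univ).indicator
      fun p : (Fin d → ℝ) × Torus d => A p.1 p.2 i j) := by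
  classical
  rw [← Set.piecewise_eq_indicator]
  exact (hA.continuousOn i j).measurable_piecewise continuousOn_const
    ((measurableSet_Omega d).prod .univ)

end

/-! ### Measurability and geometry of the dilation. -/

lemma measurable_anchor (L ν : ℝ) : Measurable (anchor L ν) := by
  unfold anchor; fun_prop

lemma measurable_shrinkVec {d : ℕ} (L m ν : ℝ) :
    Measurable (shrinkVec L m ν : (Fin d → ℝ) → Fin d → ℝ) := by
  have := measurable_anchor L ν
  unfold shrinkVec shrink; fun_prop

lemma measurable_phase {d : ℕ} (ε L m ν : ℝ) :
    Measurable (phase ε L m ν : (Fin d → ℝ) → Torus d) := by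
  have := measurable_anchor L ν
  refine continuous_proj.measurable.comp ?_
  fun_prop

lemma measurableSet_dilationDomain (d : ℕ) (L m ν : ℝ) :
    MeasurableSet (dilationDomain d L m ν) :=
  (measurableSet_Omega d).inter (measurable_shrinkVec L m ν (measurableSet_Omega d))

lemma memLinfty_tildeCoeff {d : ℕ} {A : TwoScale d} (hA : IsC1 A) (ε L m ν : ℝ) :
    MemLinfty (dilationDomain d L m ν) (tildeCoeff ε L m ν A) := by
  intro i j
  obtain ⟨C, hC⟩ := hA.exists_bound i j
  have hae : ∀ᵐ p ∂((volume.restrict (dilationDomain d L m ν)).prod (haar d)),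
      p.1 ∈ dilationDomain d L m ν :=
    Measure.quasiMeasurePreserving_fst.ae (ae_restrict_mem (measurableSet_dilationDomain d L m ν))
  refine memLp_top_of_bound ?_ C (hae.mono fun p hp => hC _ hp.2 _)
  have hm : Measurable fun p : (Fin d → ℝ) × Torus d =>
      (shrinkVec L m ν p.1, p.2 + phase ε L m ν p.1) :=
    ((measurable_shrinkVec L m ν).comp measurable_fst).prodMk
      (measurable_snd.add ((measurable_phase ε L m ν).comp measurable_fst))
  refine ((hA.measurable_indicator i j).comp hm).aestronglyMeasurable.congr
    (hae.mono fun p hp => ?_)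
  exact Set.indicator_of_mem (s := Omega d ×ˢ Set.univ) ⟨hp.2, Set.mem_univ _⟩ _

/-- On an interval of the grid, the shrinkage is a convex combination with a point of its closure. -/
lemma shrink_mem_Icc {L m ν y : ℝ} {k : ℕ} (hL : 0 < L) (hm : 1 < m) (hν : ν ∈ Set.Icc (0 : ℝ) 1)
    (h1 : ((k : ℝ) - 1) * L ≤ y) (h2 : y < k * L) :
    shrink L m ν y ∈ Set.Icc (((k : ℝ) - 1) * L) (k * L) := by
  -- The cubes are numbered from 1, so the `k`-th interval has floor `k - 1`.
  have hf : ⌊y / L⌋ = (k : ℤ) - 1 := by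
    rw [Int.floor_eq_iff, le_div_iff₀ hL, div_lt_iff₀ hL]
    push_cast
    exact ⟨h1, by linarith⟩
  have ha : anchor L ν y = ((k : ℝ) - 1 + ν) * L := by
    rw [anchor, hf]; push_cast; rfl
  have hmem : anchor L ν y ∈ Set.Icc (((k : ℝ) - 1) * L) (k * L) := by
    rw [ha]
    constructor <;> nlinarith [hν.1, hν.2]
  have hm' : 1 / m ≤ 1 := by rw [div_le_one (by linarith)]; exact hm.le
  have := (convex_Icc (((k : ℝ) - 1) * L) (k * L)) (⟨h1, h2.le⟩ : y ∈ Set.Icc _ _) hmem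
    (a := 1 / m) (b := 1 - 1 / m) (by positivity) (by linarith) (by ring)
  convert this using 1
  simp only [shrink, smul_eq_mul]; ring

lemma cell_subset_dilationDomain {d : ℕ} {L m ν : ℝ} (hL : 0 < L) (hm : 1 < m)
    (hν : ν ∈ Set.Icc (0 : ℝ) 1) {k : Fin d → ℕ} (hk : ∀ i, 1 ≤ k i ∧ (k i : ℝ) ≤ 1 / L) :
    cell L k ⊆ dilationDomain d L m ν := by
  intro x hx
  have h : ∀ i, Set.Icc (((k i : ℝ) - 1) * L) (k i * L) ⊆ Set.Icc 0 1 := fun i => by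
    have h1 : (1 : ℝ) ≤ k i := by exact_mod_cast (hk i).1
    exact Set.Icc_subset_Icc (by nlinarith) ((le_div_iff₀ hL).1 (hk i).2)
  have hx' := fun i => h i ⟨(hx i).1, (hx i).2.le⟩
  have hs := fun i => h i (shrink_mem_Icc hL hm hν (hx i).1 (hx i).2)
  exact ⟨⟨fun i => (hx' i).1, fun i => (hx' i).2⟩, fun i => (hs i).1, fun i => (hs i).2⟩

lemma ae_mem_dilationDomain {d : ℕ} {L m ν : ℝ} (hL : 0 < L) (hm : 1 < m)
    (hν : ν ∈ Set.Icc (0 : ℝ) 1) (hN : ∃ N : ℕ, (N : ℝ) * L = 1) :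
    ∀ᵐ x ∂(volume.restrict (Omega d)), x ∈ dilationDomain d L m ν := by
  obtain ⟨N, hN⟩ := hN
  -- The half-open cubes miss only the faces `x i = 1` of `Ω`, a null set.
  have hne : ∀ᵐ x : Fin d → ℝ, ∀ i, x i ≠ 1 := by
    refine Filter.eventually_all.2 fun i => ?_
    exact (Measure.quasiMeasurePreserving_eval (fun _ : Fin d => (volume : Measure ℝ)) i).ae
      (Measure.ae_ne volume 1)
  filter_upwards [ae_restrict_mem (measurableSet_Omega d), ae_restrict_of_ae hne] with x hx hx1
  have hlt : ∀ i, x i < 1 := fun i => lt_of_le_of_ne (hx.2 i) (hx1 i)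
  refine cell_subset_dilationDomain (k := fun i => ⌊x i / L⌋₊ + 1) hL hm hν (fun i => ⟨by simp, ?_⟩)
    fun i => ⟨?_, ?_⟩
  · have h1 : ⌊x i / L⌋₊ < N := by
      rw [Nat.floor_lt (div_nonneg (hx.1 i) hL.le), div_lt_iff₀ hL, hN]
      exact hlt i
    rw [le_div_iff₀ hL, ← hN]
    gcongr
    exact_mod_cast h1
  · push_cast
    rw [add_sub_cancel_right, ← le_div_iff₀ hL]
    exact Nat.floor_le (div_nonneg (hx.1 i) hL.le)
  · push_cast
    rw [← div_lt_iff₀ hL]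
    exact Nat.lt_floor_add_one _

/-- The phase is exactly the correction in `φ(x)/ε = x/(mε) + ε⁻¹ (1 - 1/m) Φ(x)`. -/
lemma wrap_tildeCoeff {d : ℕ} (A : TwoScale d) {ε L m ν : ℝ} (hε : 0 < ε) (hm : 1 < m)
    (x : Fin d → ℝ) :
    wrap (m * ε) (tildeCoeff ε L m ν A) x = dilate L m ν (wrap ε A) x := by
  have hm0 : m ≠ 0 := by positivity
  simp only [wrap, tildeCoeff, dilate, phase, ← proj_add]
  congr 2
  ext i
  simp only [Pi.add_apply, shrinkVec, shrink]
  field_simp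
  ring

end LocalDilation

/-! ### The main theorem. -/

open LocalDilation
theorem mainTheorem6 (d : ℕ) (A : TwoScale d) (hA : IsC1 A)
    (r : ℝ) (hr : 0 < r) (hell : IsElliptic r A)
    (ε L m ν : ℝ) (hε : 0 < ε) (hL : 0 < L) (hm : 1 < m) (hν : ν ∈ Set.Icc (0 : ℝ) 1) :
    -- the dilation is defined on every cube `T_k`, and a.e. on `Ω` if the cubes fill `Ω`
    (∀ k : Fin d → ℕ, (∀ i, 1 ≤ k i ∧ (k i : ℝ) ≤ 1 / L) → cell L k ⊆ dilationDomain d L m ν) ∧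
    ((∃ N : ℕ, (N : ℝ) * L = 1) →
      ∀ᵐ x ∂(volume.restrict (Omega d)), x ∈ dilationDomain d L m ν) ∧
    -- `Ã` is a bounded two-scale coefficient with `ι^{mε} Ã = 𝒟 A^ε`
    MemLinfty (dilationDomain d L m ν) (tildeCoeff ε L m ν A) ∧
    (∀ x ∈ dilationDomain d L m ν,
      wrap (m * ε) (tildeCoeff ε L m ν A) x = dilate L m ν (wrap ε A) x) ∧
    -- `ℋ A` and `ℋ Ã` are well defined: correctors exist, and any of them gives the same value
    (∀ x ∈ Omega d, (∃ χ G, IsCorrector (A x) χ G) ∧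
      ∀ χ G, IsCorrector (A x) χ G → homogenize A x = cellAverage (A x) G) ∧
    (∀ x ∈ dilationDomain d L m ν, (∃ χ G, IsCorrector (tildeCoeff ε L m ν A x) χ G) ∧
      ∀ χ G, IsCorrector (tildeCoeff ε L m ν A x) χ G →
        homogenize (tildeCoeff ε L m ν A) x = cellAverage (tildeCoeff ε L m ν A x) G) ∧
    -- the correctors of `Ã` at `x` are the translates of those of `A` at `φ(x)`
    (∀ x ∈ dilationDomain d L m ν, ∀ χ G,
      IsCorrector (A (shrinkVec L m ν x)) χ G ↔
        IsCorrector (tildeCoeff ε L m ν A x) (fun t => χ (t + phase ε L m ν x))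
          (fun t => G (t + phase ε L m ν x))) ∧
    -- homogenization commutes with local dilation
    (∀ x ∈ dilationDomain d L m ν,
      homogenize (tildeCoeff ε L m ν A) x = dilate L m ν (homogenize A) x) ∧
    ((∃ N : ℕ, (N : ℝ) * L = 1) →
      homogenize (tildeCoeff ε L m ν A) =ᵐ[volume.restrict (Omega d)]
        dilate L m ν (homogenize A)) := by
  have hcont {x} (hx : x ∈ Omega d) := hA.continuous_apply hx
  have hcont' {x} (hx : x ∈ dilationDomain d L m ν) :
      ∀ k l, Continuous fun t => tildeCoeff ε L m ν A x t k l := fun k l =>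
    (hcont hx.2 k l).comp (continuous_add_const _)
  have hell' {x} (hx : x ∈ dilationDomain d L m ν) (t : Torus d) :=
    hell _ hx.2 (t + phase ε L m ν x)
  -- One corrector at `φ(x)` and its translate by the phase compute the two sides; invariance of the
  -- average identifies them.
  have hcomm : ∀ x ∈ dilationDomain d L m ν,
      homogenize (tildeCoeff ε L m ν A) x = dilate L m ν (homogenize A) x := fun x hx => by
    obtain ⟨χ, G, h⟩ := exists_isCorrector (hcont hx.2) hr (hell _ hx.2)
    rw [dilate, homogenize_eq (hcont hx.2) hr (hell _ hx.2) h,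
      homogenize_eq (hcont' hx) hr (hell' hx) (h.comp_add_right (phase ε L m ν x))]
    exact cellAverage_comp_add_right G _
  refine ⟨fun k hk => cell_subset_dilationDomain hL hm hν hk, ae_mem_dilationDomain hL hm hν,
    memLinfty_tildeCoeff hA ε L m ν, fun x _ => wrap_tildeCoeff A hε hm x,
    fun x hx => ⟨exists_isCorrector (hcont hx) hr (hell x hx),
      fun χ G h => homogenize_eq (hcont hx) hr (hell x hx) h⟩,
    fun x hx => ⟨exists_isCorrector (hcont' hx) hr (hell' hx),
      fun χ G h => homogenize_eq (hcont' hx) hr (hell' hx) h⟩,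
    fun x _ χ G => isCorrector_comp_add_right_iff _, hcomm,
    fun hN => (ae_mem_dilationDomain hL hm hν hN).mono hcomm⟩
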